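/- Let $n\ge 7$ be odd, put $D=(n-1)/2$, and let $\Gamma=\tfrac12H(n,2)$ be the halved cube: its vertices are the binary words of length $n$ of even weight, two being adjacent when they are at Hamming distance $2$. Let $X$ be the vertex set of $\Gamma$ and let $\partial$ be its distance function. The diameter of $\Gamma$ is $D$. Fix $x\in X$, let $A$ be the adjacency matrix of $\Gamma$, let $V=\mathbb C^X$, for $0\le i\le D$ let $E^*_i$ be the diagonal matrix with $(y,y)$-entry $1$ if $\partial(x,y)=i$ and $0$ otherwise, and put $L=\sum_{i=1}^{D}E^*_{i-1}AE^*_i$ and $R=\sum_{i=0}^{D-1}E^*_{i+1}AE^*_i$. Then $$e_i^-RL^2+LRL+e_i^+L^2R=f_iL$$ is satisfied on $E^*_iV$ for $1\le i\le D$, where $e_1^-=0$, $e_D^+=0$ and $$e_i^-=\frac{4i-1-2D}{6-8i+4D}\ (2\le i\le D),\qquad e_i^+=\frac{4i-5-2D}{6-8i+4D}\ (1\le i\le D-1),$$ $$f_i=-(4i-5)(4i-1)+(16i-12)D-4D^2\ (1\le i\le D);$$ the denominators $6-8i+4D$ $(1\le i\le D)$ are nonzero, and so are $e_i^-$ for $2\le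 i\le D$ and $e_i^+$ for $1\le i\le D-1$. Let $U$ be the tridiagonal $D\times D$ matrix with rows and columns indexed by $1,\dots,D$, diagonal entries $1$, $(i,i-1)$-entries $e_i^-$ and $(i,i+1)$-entries $e_i^+$, and for $1\le s\le t\le D$ let $U_{s,t}$ be its principal submatrix on the indices $s,\dots,t$. Then $$\det(U_{s,t})=\frac{(t-s+2)(2D-2t-2s+3)\prod_{k=0}^{t-s-1}(2D-4t+5+4k)}{2^{\,t-s+1}\prod_{k=0}^{t-s}(2D-4t+3+4k)}\neq 0,$$ where the denominator is nonzero. In particular, $(U,(f_i)_{i=1}^D)$ is a strongly uniform structure with respect to $x$ of the connected bipartite graph $\Gamma_f$ obtained from the connected non-bipartite graph $\Gamma$ by deleting all edges $yz$ with $\partial(x,y)=\partial(x,z)$; that is, $\Gamma$ supports a strongly uniform structure with respect to $x$. Here, for a finite connected bipartite graph and a vertex $x$ of eccentricity $\varepsilon$, with $L$, $R$ and $E_i^*$ defined as above but from that graph and with $\varepsilon$ in place of $D$, a uniform structure with respect to $x$ is a pair $(U,f)$ of a complex tridiagonal $\varepsilon\times\varepsilon$ matrix $U=(e_{ij})_{1\le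 i,j\le\varepsilon}$ and a vector $f\in\mathbb C^\varepsilon$ such that $e_{ii}=1$ for all $i$; either $e_{i,i-1}\ne0$ for all $2\le i\le\varepsilon$, or $e_{i-1,i}\neq 0$ for all $2\le i\le\varepsilon$; the principal submatrix of $U$ on the indices $s,\dots,t$ is nonsingular for all $1\le s\le t\le\varepsilon$; and $e_i^-RL^2+LRL+e_i^+L^2R=f_iL$ on $E_i^*V$ for $1\le i\le\varepsilon$, where $e_i^-=e_{i,i-1}$ for $i\ge 2$, $e_i^+=e_{i,i+1}$ for $i\le\varepsilon-1$, and $e_1^-=e_\varepsilon^+=0$. It is strongly uniform if moreover $e_i^-\ne0$ for $2\le i\le\varepsilon$ and $e_i^+\ne0$ for $1\le i\le\varepsilon-1$. -/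

import Mathlib

open scoped Matrix

noncomputable section

/-! ## Lowering, raising matrices and uniform structures -/

namespace UniformGraph

/-- The eccentricity `ε(x)` of a vertex (as a natural number; all graphs of interest are finite
and connected). -/
def ecc {X : Type*} (G : SimpleGraph X) (x : X) : ℕ := (G.eccent x).toNat

/-- The adjacency matrix over `ℂ`. -/
def adj {X : Type*} (G : SimpleGraph X) : Matrix X X ℂ :=
  open Classical in G.adjMatrix ℂ

/-- The `i`-th dual idempotent `E*_i` with respect to `x`. -/
def dualIdempotent {X : Type*} [DecidableEq X] (G : SimpleGraph X) (x : X) (i : ℕ) :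
    Matrix X X ℂ :=
  Matrix.diagonal fun y => if G.dist x y = i then 1 else 0

/-- The lowering matrix `L = ∑_{i=1}^{ε} E*_{i-1} A E*_i`. -/
def lowering {X : Type*} [Fintype X] [DecidableEq X] (G : SimpleGraph X) (x : X) :
    Matrix X X ℂ :=
  ∑ i ∈ Finset.Icc 1 (ecc G x), dualIdempotent G x (i - 1) * adj G * dualIdempotent G x i

/-- The raising matrix `R = ∑_{i=0}^{ε-1} E*_{i+1} A E*_i`. -/
def raising {X : Type*} [Fintype X] [DecidableEq X] (G : SimpleGraph X) (x : X) :
    Matrix X X ℂ :=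
  ∑ i ∈ Finset.range (ecc G x), dualIdempotent G x (i + 1) * adj G * dualIdempotent G x i

/-- The subconstituent `E*_i V`, where `V = ℂ^X` is the standard module. -/
def subconstituent {X : Type*} [Fintype X] [DecidableEq X] (G : SimpleGraph X) (x : X) (i : ℕ) :
    Submodule ℂ (X → ℂ) :=
  LinearMap.range (dualIdempotent G x i).mulVecLin

/-- The relation `e⁻ R L² + L R L + e⁺ L² R = f L` is satisfied on `E*_i V`. -/
def UniformRelationOn {X : Type*} [Fintype X] [DecidableEq X] (G : SimpleGraph X) (x : X) (i : ℕ)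
    (eMinus ePlus f : ℂ) : Prop :=
  ∀ v ∈ subconstituent G x i,
    (eMinus • (raising G x * lowering G x ^ 2) + lowering G x * raising G x * lowering G x
      + ePlus • (lowering G x ^ 2 * raising G x)) *ᵥ v = (f • lowering G x) *ᵥ v

/-- The principal submatrix `(e_{ij})_{s ≤ i, j ≤ t}` of a matrix with indices `1, …, ε`. -/
def principalSubmatrix {ε : ℕ} (U : Matrix (Finset.Icc 1 ε) (Finset.Icc 1 ε) ℂ) (s t : ℕ) :
    Matrix {i : Finset.Icc 1 ε // s ≤ i.1 ∧ i.1 ≤ t} {i : Finset.Icc 1 ε // s ≤ i.1 ∧ i.1 ≤ t} ℂ :=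
  U.submatrix Subtype.val Subtype.val

/-- `e_i⁻ = e_{i,i-1}` for `2 ≤ i ≤ ε`, and `e_1⁻ = 0`. -/
def eMinus {ε : ℕ} (U : Matrix (Finset.Icc 1 ε) (Finset.Icc 1 ε) ℂ) (i : ℕ) : ℂ :=
  if h : 2 ≤ i ∧ i ≤ ε then
    U ⟨i, Finset.mem_Icc.2 (by omega)⟩ ⟨i - 1, Finset.mem_Icc.2 (by omega)⟩ else 0

/-- `e_i⁺ = e_{i,i+1}` for `1 ≤ i ≤ ε - 1`, and `e_ε⁺ = 0`. -/
def ePlus {ε : ℕ} (U : Matrix (Finset.Icc 1 ε) (Finset.Icc 1 ε) ℂ) (i : ℕ) : ℂ :=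
  if h : 1 ≤ i ∧ i + 1 ≤ ε then
    U ⟨i, Finset.mem_Icc.2 (by omega)⟩ ⟨i + 1, Finset.mem_Icc.2 (by omega)⟩ else 0

/-- Parameter matrices with indices `1, …, ε`. -/
structure IsParameterMatrix {ε : ℕ} (U : Matrix (Finset.Icc 1 ε) (Finset.Icc 1 ε) ℂ) : Prop where
  tridiagonal : ∀ i j : Finset.Icc 1 ε, (i.1 + 1 < j.1 ∨ j.1 + 1 < i.1) → U i j = 0
  diag : ∀ i, U i i = 1
  offDiag : (∀ i, 2 ≤ i → i ≤ ε → eMinus U i ≠ 0) ∨ (∀ i, 2 ≤ i → i ≤ ε → ePlus U (i - 1) ≠ 0)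
  nonsingular : ∀ s t, 1 ≤ s → s ≤ t → t ≤ ε → (principalSubmatrix U s t).det ≠ 0

/-- `(U, f)` is a uniform structure, with respect to `x`, of the (connected) bipartite graph `G`.
The size `ε` of `U` and of `f` is the eccentricity of `x`. -/
structure IsUniformStructure {X : Type*} [Fintype X] [DecidableEq X] (G : SimpleGraph X) (x : X)
    {ε : ℕ} (U : Matrix (Finset.Icc 1 ε) (Finset.Icc 1 ε) ℂ) (f : Finset.Icc 1 ε → ℂ) : Prop where
  connected : G.Connected
  bipartite : G.IsBipartite
  ecc_eq : ecc G x = ε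
  isParameterMatrix : IsParameterMatrix U
  relation : ∀ i : Finset.Icc 1 ε, UniformRelationOn G x i.1 (eMinus U i.1) (ePlus U i.1) (f i)

/-- Strongly uniform structures. -/
structure IsStronglyUniformStructure {X : Type*} [Fintype X] [DecidableEq X] (G : SimpleGraph X)
    (x : X) {ε : ℕ} (U : Matrix (Finset.Icc 1 ε) (Finset.Icc 1 ε) ℂ) (f : Finset.Icc 1 ε → ℂ) :
    Prop extends IsUniformStructure G x U f where
  eMinus_ne_zero : ∀ i, 2 ≤ i → i ≤ ε → eMinus U i ≠ 0
  ePlus_ne_zero : ∀ i, 1 ≤ i → i + 1 ≤ ε → ePlus U i ≠ 0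

/-- The graph `Γ_f(x)`: delete from `Γ` all edges `yz` with `∂(x,y) = ∂(x,z)`. -/
def flatFree {X : Type*} (G : SimpleGraph X) (x : X) : SimpleGraph X where
  Adj y z := G.Adj y z ∧ G.dist x y ≠ G.dist x z
  symm := ⟨fun _ _ h => ⟨h.1.symm, h.2.symm⟩⟩
  loopless := ⟨fun _ h => h.2 rfl⟩

/-- A connected non-bipartite graph `G` supports a strongly uniform structure with respect to `x`
if `Γ_f(x)` admits one. -/
def SupportsStronglyUniformStructure {X : Type*} [Fintype X] [DecidableEq X] (G : SimpleGraph X)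
    (x : X) : Prop :=
  G.Connected ∧ ¬ G.IsBipartite ∧
    ∃ (ε : ℕ) (U : Matrix (Finset.Icc 1 ε) (Finset.Icc 1 ε) ℂ) (f : Finset.Icc 1 ε → ℂ),
      IsStronglyUniformStructure (flatFree G x) x U f

/-- The tridiagonal matrix with indices `1, …, ε`, ones on the diagonal, `(i, i-1)`-entry `a i`
and `(i, i+1)`-entry `b i`. -/
def tridiagonal (ε : ℕ) (a b : ℕ → ℂ) : Matrix (Finset.Icc 1 ε) (Finset.Icc 1 ε) ℂ :=
  Matrix.of fun i j =>
    if i.1 = j.1 then 1 else if i.1 = j.1 + 1 then a i.1 else if j.1 = i.1 + 1 then b i.1 else 0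

end UniformGraph

/-! ## The halved cube -/

namespace HalvedCube

/-- The binary words of length `n` of even weight. -/
abbrev Vertex (n : ℕ) : Type := {v : Fin n → ZMod 2 // Even (hammingNorm v)}

/-- The halved cube `½H(n,2)`: words of even weight, adjacent when at Hamming distance two. -/
def graph (n : ℕ) : SimpleGraph (Vertex n) where
  Adj u v := hammingDist u.1 v.1 = 2
  symm := ⟨fun u v h => by rw [hammingDist_comm]; exact h⟩
  loopless := ⟨fun u h => by simp at h⟩

/-- `e_i⁻ = (4i-1-2D)/(6-8i+4D)` for `2 ≤ i ≤ D`, and `0` for other `i`. -/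
def eMinus (D i : ℕ) : ℂ :=
  if 2 ≤ i ∧ i ≤ D then (4 * (i : ℂ) - 1 - 2 * (D : ℂ)) / (6 - 8 * (i : ℂ) + 4 * (D : ℂ)) else 0

/-- `e_i⁺ = (4i-5-2D)/(6-8i+4D)` for `1 ≤ i ≤ D-1`, and `0` for other `i`. -/
def ePlus (D i : ℕ) : ℂ :=
  if 1 ≤ i ∧ i + 1 ≤ D then
    (4 * (i : ℂ) - 5 - 2 * (D : ℂ)) / (6 - 8 * (i : ℂ) + 4 * (D : ℂ)) else 0

/-- `f_i = -(4i-5)(4i-1) + (16i-12)D - 4D²`. -/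
def fCoeff (D i : ℕ) : ℂ :=
  -(4 * (i : ℂ) - 5) * (4 * (i : ℂ) - 1) + (16 * (i : ℂ) - 12) * (D : ℂ) - 4 * (D : ℂ) ^ 2

/-- The parameter matrix `U` with indices `1, …, D`, formed from the `e_i⁻` and `e_i⁺`. -/
def paramMatrix (D : ℕ) : Matrix (Finset.Icc 1 D) (Finset.Icc 1 D) ℂ :=
  UniformGraph.tridiagonal D (eMinus D) (ePlus D)

end HalvedCube

end

/-!
Recording a vertex `y` by the set of positions in which it differs from `x` embeds the standard
module of the halved cube into the functions on the Boolean lattice. There the lowering and raising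
operators form an `sl₂`-triple in which a set of size `k` has weight `n - 2k`, and `L`, `R` become
half the squares of these operators. The uniform relation on `E*_i V` is then an identity in
`sl₂` acting on a vector of weight `μ = 2D + 1 - 4i`, and it produces the coefficients
`e_i⁻ = -μ / (2(μ + 2))`, `e_i⁺ = -(μ + 4) / (2(μ + 2))`, `f_i = -μ(μ + 4)`. Multiplying each row
of `U` by its denominator turns the principal minors into solutions of a polynomial three-term
recurrence with an explicit solution.
-/

noncomputable section

section Tridiagonal

variable {R : Type*} [CommRing R]

/-- The tridiagonal `m × m` matrix with `(i, i)`-entries `d i`, `(i, i + 1)`-entries `a i` and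
`(i + 1, i)`-entries `b i`; its determinant is a continuant. -/
def finTridiagonal (d a b : ℕ → R) (m : ℕ) : Matrix (Fin m) (Fin m) R :=
  Matrix.of fun i j =>
    if i.1 = j.1 then d i else if j.1 = i.1 + 1 then a i else if i.1 = j.1 + 1 then b j else 0

theorem finTridiagonal_congr {d a b a' b' : ℕ → R} {m : ℕ}
    (ha : ∀ k, k + 1 < m → a k = a' k) (hb : ∀ k, k + 1 < m → b k = b' k) :
    finTridiagonal d a b m = finTridiagonal d a' b' m := by
  ext i j
  simp only [finTridiagonal, Matrix.of_apply]
  split_ifs with _ hij hji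
  · rfl
  · exact ha i (by omega)
  · exact hb j (by omega)
  · rfl

theorem prod_mul_det_finTridiagonal (r d a b : ℕ → R) (m : ℕ) :
    (∏ k ∈ Finset.range m, r k) * (finTridiagonal d a b m).det =
      (finTridiagonal (fun k => r k * d k) (fun k => r k * a k)
        (fun k => r (k + 1) * b k) m).det := by
  rw [Finset.prod_range, ← Matrix.det_mul_column]
  congr 1
  ext i j
  simp only [finTridiagonal, Matrix.of_apply, mul_ite, mul_zero]
  split_ifs with _ _ hji
  · rfl
  · rfl
  · rw [hji]
  · rfl

theorem det_finTridiagonal_add_two (d a b : ℕ → R) (m : ℕ) :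
    (finTridiagonal d a b (m + 2)).det =
      d 0 * (finTridiagonal (d <| · + 1) (a <| · + 1) (b <| · + 1) (m + 1)).det -
        a 0 * b 0 * (finTridiagonal (d <| · + 2) (a <| · + 2) (b <| · + 2) m).det := by
  have minor_zero : (finTridiagonal d a b (m + 2)).submatrix Fin.succ (Fin.succAbove 0) =
      finTridiagonal (d <| · + 1) (a <| · + 1) (b <| · + 1) (m + 1) := by
    ext i j
    simp [finTridiagonal]
  have det_minor_one :
      ((finTridiagonal d a b (m + 2)).submatrix Fin.succ (Fin.succAbove 1)).det =
        b 0 * (finTridiagonal (d <| · + 2) (a <| · + 2) (b <| · + 2) m).det := by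
    rw [Matrix.det_succ_column_zero, Fin.sum_univ_succ, Finset.sum_eq_zero, add_zero]
    · congr 1
      · simp [finTridiagonal]
      · congr 1
        ext i j
        simp [finTridiagonal]
    · simp [finTridiagonal]
  rw [Matrix.det_succ_row_zero, Fin.sum_univ_succ, Fin.sum_univ_succ, Finset.sum_eq_zero, add_zero,
    minor_zero, Fin.succ_zero_eq_one, det_minor_one]
  · simp [finTridiagonal]
    ring
  · simp [finTridiagonal]

theorem prod_range_succ_add_four_mul (a : R) (m : ℕ) :
    ∏ k ∈ Finset.range (m + 1), (a + 4 * k) = a * ∏ k ∈ Finset.range m, (a + 4 + 4 * k) := by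
  rw [Finset.prod_range_succ', mul_comm]
  congr 1
  · simp
  · refine Finset.prod_congr rfl fun k _ => ?_
    push_cast
    ring

end Tridiagonal

namespace UniformGraph

theorem det_principalSubmatrix_tridiagonal {ε s t : ℕ} (a b : ℕ → ℂ) (hs : 1 ≤ s) (hst : s ≤ t)
    (ht : t ≤ ε) :
    (principalSubmatrix (tridiagonal ε a b) s t).det =
      (finTridiagonal (fun _ => 1) (fun k => a (t - k)) (fun k => b (t - (k + 1)))
        (t - s + 1)).det := by
  let countDown : Fin (t - s + 1) ≃ {i : Finset.Icc 1 ε // s ≤ i.1 ∧ i.1 ≤ t} :=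
    { toFun k := ⟨⟨t - k.1, Finset.mem_Icc.2 (by omega)⟩, by constructor <;> dsimp only <;> omega⟩
      invFun i := ⟨t - i.1.1, by have := i.2; omega⟩
      left_inv k := by ext; dsimp only; omega
      right_inv i := by
        have := i.2
        ext
        dsimp only
        omega }
  rw [← Matrix.det_submatrix_equiv_self countDown]
  congr 1
  ext k l
  have diag_iff : t - k.1 = t - l.1 ↔ k.1 = l.1 := by omega
  have super_iff : t - k.1 = t - l.1 + 1 ↔ l.1 = k.1 + 1 := by omega
  have sub_iff : t - l.1 = t - k.1 + 1 ↔ k.1 = l.1 + 1 := by omega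
  simp only [principalSubmatrix, tridiagonal, finTridiagonal, Matrix.submatrix_apply,
    Matrix.of_apply, countDown, Equiv.coe_fn_mk, diag_iff, super_iff, sub_iff]
  split_ifs with _ _ hkl
  · rfl
  · rfl
  · rw [hkl]
  · rfl

end UniformGraph

namespace HalvedCube

theorem ne_zero_of_eq_intCast_odd {z : ℂ} {m : ℤ} (hz : z = m) (hm : Odd m) : z ≠ 0 := by
  rw [hz, Int.cast_ne_zero]
  rintro rfl
  exact absurd hm (by decide)

theorem denominator_ne_zero (D i : ℕ) : 6 - 8 * (i : ℂ) + 4 * (D : ℂ) ≠ 0 := by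
  have half_ne_zero : 3 - 4 * (i : ℂ) + 2 * (D : ℂ) ≠ 0 :=
    ne_zero_of_eq_intCast_odd (m := 3 - 4 * i + 2 * D) (by push_cast; ring)
      ⟨1 - 2 * i + D, by ring⟩
  have double : 6 - 8 * (i : ℂ) + 4 * (D : ℂ) = 2 * (3 - 4 * (i : ℂ) + 2 * (D : ℂ)) := by ring
  rw [double]
  exact mul_ne_zero two_ne_zero half_ne_zero

theorem denominator_mul_eMinus {D i : ℕ} (h2 : 2 ≤ i) (hi : i ≤ D) :
    (6 - 8 * (i : ℂ) + 4 * (D : ℂ)) * eMinus D i = 4 * i - 1 - 2 * D := by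
  rw [eMinus, if_pos ⟨h2, hi⟩, mul_div_cancel₀ _ (denominator_ne_zero D i)]

theorem denominator_mul_ePlus {D i : ℕ} (h1 : 1 ≤ i) (hi : i + 1 ≤ D) :
    (6 - 8 * (i : ℂ) + 4 * (D : ℂ)) * ePlus D i = 4 * i - 5 - 2 * D := by
  rw [ePlus, if_pos ⟨h1, hi⟩, mul_div_cancel₀ _ (denominator_ne_zero D i)]

theorem eMinus_ne_zero {D i : ℕ} (h2 : 2 ≤ i) (hi : i ≤ D) : eMinus D i ≠ 0 := by
  refine right_ne_zero_of_mul (a := 6 - 8 * (i : ℂ) + 4 * (D : ℂ)) ?_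
  rw [denominator_mul_eMinus h2 hi]
  exact ne_zero_of_eq_intCast_odd (m := 4 * i - 1 - 2 * D) (by push_cast; ring)
    ⟨2 * i - 1 - D, by ring⟩

theorem ePlus_ne_zero {D i : ℕ} (h1 : 1 ≤ i) (hi : i + 1 ≤ D) : ePlus D i ≠ 0 := by
  refine right_ne_zero_of_mul (a := 6 - 8 * (i : ℂ) + 4 * (D : ℂ)) ?_
  rw [denominator_mul_ePlus h1 hi]
  exact ne_zero_of_eq_intCast_odd (m := 4 * i - 5 - 2 * D) (by push_cast; ring)
    ⟨2 * i - 3 - D, by ring⟩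

theorem prod_odd_ne_zero (D t l m : ℕ) :
    ∏ k ∈ Finset.range m, (2 * (D : ℂ) - 4 * (t : ℂ) + (2 * l + 1 : ℕ) + 4 * (k : ℂ)) ≠ 0 :=
  Finset.prod_ne_zero_iff.2 fun k _ =>
    ne_zero_of_eq_intCast_odd (m := 2 * D - 4 * t + (2 * l + 1) + 4 * k) (by push_cast; ring)
      ⟨D - 2 * t + l + 2 * k, by ring⟩

theorem prod_add_three_ne_zero (D t m : ℕ) :
    ∏ k ∈ Finset.range m, (2 * (D : ℂ) - 4 * (t : ℂ) + 3 + 4 * (k : ℂ)) ≠ 0 := by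
  simpa using prod_odd_ne_zero D t 1 m

theorem prod_add_five_ne_zero (D t m : ℕ) :
    ∏ k ∈ Finset.range m, (2 * (D : ℂ) - 4 * (t : ℂ) + 5 + 4 * (k : ℂ)) ≠ 0 := by
  simpa using prod_odd_ne_zero D t 2 m

theorem eMinus_paramMatrix (D i : ℕ) :
    UniformGraph.eMinus (paramMatrix D) i = eMinus D i := by
  unfold UniformGraph.eMinus
  split_ifs with h
  · simp only [paramMatrix, UniformGraph.tridiagonal, Matrix.of_apply]
    rw [if_neg (by omega), if_pos (by omega)]
  · rw [eMinus, if_neg h]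

theorem ePlus_paramMatrix (D i : ℕ) :
    UniformGraph.ePlus (paramMatrix D) i = ePlus D i := by
  unfold UniformGraph.ePlus
  split_ifs with h
  · simp only [paramMatrix, UniformGraph.tridiagonal, Matrix.of_apply]
    rw [if_neg (by omega), if_neg (by omega), if_pos trivial]
  · rw [ePlus, if_neg h]

/-- The principal submatrix of `paramMatrix D` on the indices `t - m + 1, …, t`, listed downwards
from `t`, after the row of each index `i` has been multiplied by the denominator
`2 (2D - 4i + 3)`. The parameter `c` stands for `2D - 4t + 3`. -/
def clearedParamMatrix {R : Type*} [CommRing R] (c : R) (m : ℕ) : Matrix (Fin m) (Fin m) R :=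
  finTridiagonal (fun k => 2 * (c + 4 * k)) (fun k => 2 - (c + 4 * k))
    (fun k => -(c + 4 * k + 6)) m

theorem det_clearedParamMatrix_add_two {R : Type*} [CommRing R] (c : R) (m : ℕ) :
    (clearedParamMatrix c (m + 2)).det = 2 * c * (clearedParamMatrix (c + 4) (m + 1)).det -
      (c - 2) * (c + 6) * (clearedParamMatrix (c + 8) m).det := by
  have shift (j k : ℕ) : c + 4 * ((k + j : ℕ) : R) = c + 4 * j + 4 * k := by
    push_cast
    ring
  simp only [clearedParamMatrix, det_finTridiagonal_add_two, shift]
  push_cast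
  ring_nf

theorem det_clearedParamMatrix_succ {R : Type*} [CommRing R] (c : R) (m : ℕ) :
    (clearedParamMatrix c (m + 1)).det =
      (m + 2) * (c + 2 * m) * ∏ k ∈ Finset.range m, (c + 2 + 4 * k) := by
  induction m using Nat.twoStepInduction generalizing c with
  | zero => simp [clearedParamMatrix, finTridiagonal]
  | one =>
    rw [det_clearedParamMatrix_add_two]
    simp [clearedParamMatrix, finTridiagonal]
    ring
  | more m ih ih' =>
    have shift : c + 4 + 2 = c + 2 + 4 := by ring
    have shift' : c + 8 + 2 = c + 2 + 4 + 4 := by ring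
    rw [det_clearedParamMatrix_add_two, ih, ih', shift, shift']
    simp only [prod_range_succ_add_four_mul]
    push_cast
    ring

theorem prod_mul_det_principalSubmatrix_paramMatrix {D s t : ℕ} (hs : 1 ≤ s) (hst : s ≤ t)
    (ht : t ≤ D) :
    (∏ k ∈ Finset.range (t - s + 1), (2 * (2 * (D : ℂ) - 4 * t + 3 + 4 * k))) *
        (UniformGraph.principalSubmatrix (paramMatrix D) s t).det =
      (clearedParamMatrix (2 * (D : ℂ) - 4 * t + 3) (t - s + 1)).det := by
  rw [paramMatrix, UniformGraph.det_principalSubmatrix_tridiagonal _ _ hs hst ht,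
    prod_mul_det_finTridiagonal, clearedParamMatrix]
  simp only [mul_one]
  congr 1
  refine finTridiagonal_congr (fun k hk => ?_) fun k hk => ?_
  · have cast_index : ((t - k : ℕ) : ℂ) = t - k := Nat.cast_sub (by omega)
    have cleared := denominator_mul_eMinus (D := D) (i := t - k) (by omega) (by omega)
    rw [cast_index] at cleared
    linear_combination cleared
  · have cast_index : ((t - (k + 1) : ℕ) : ℂ) = t - (k + 1) := by
      rw [Nat.cast_sub (by omega), Nat.cast_succ]
    have cleared := denominator_mul_ePlus (D := D) (i := t - (k + 1)) (by omega) (by omega)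
    rw [cast_index] at cleared
    push_cast
    linear_combination cleared

theorem det_principalSubmatrix_paramMatrix {D s t : ℕ} (hs : 1 ≤ s) (hst : s ≤ t) (ht : t ≤ D) :
    (UniformGraph.principalSubmatrix (paramMatrix D) s t).det =
      (((t : ℂ) - (s : ℂ) + 2) * (2 * (D : ℂ) - 2 * (t : ℂ) - 2 * (s : ℂ) + 3) *
        ∏ k ∈ Finset.range (t - s), (2 * (D : ℂ) - 4 * (t : ℂ) + 5 + 4 * (k : ℂ))) /
      (2 ^ (t - s + 1) *
        ∏ k ∈ Finset.range (t - s + 1), (2 * (D : ℂ) - 4 * (t : ℂ) + 3 + 4 * (k : ℂ))) := by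
  have cleared := prod_mul_det_principalSubmatrix_paramMatrix hs hst ht
  rw [Finset.prod_mul_distrib, Finset.prod_const, Finset.card_range, det_clearedParamMatrix_succ,
    Nat.cast_sub hst] at cleared
  rw [eq_div_iff (mul_ne_zero (by simp) (prod_add_three_ne_zero D t _)), mul_comm, cleared]
  ring_nf

theorem det_principalSubmatrix_paramMatrix_ne_zero {D s t : ℕ} (hs : 1 ≤ s) (hst : s ≤ t)
    (ht : t ≤ D) : (UniformGraph.principalSubmatrix (paramMatrix D) s t).det ≠ 0 := by
  rw [det_principalSubmatrix_paramMatrix hs hst ht]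
  have size_ne_zero : (t : ℂ) - s + 2 ≠ 0 := by
    rw [← Nat.cast_sub hst]
    exact_mod_cast Nat.succ_ne_zero (t - s + 1)
  have linear_ne_zero : 2 * (D : ℂ) - 2 * t - 2 * s + 3 ≠ 0 :=
    ne_zero_of_eq_intCast_odd (m := 2 * D - 2 * t - 2 * s + 3) (by push_cast; ring)
      ⟨D - t - s + 1, by ring⟩
  exact div_ne_zero (mul_ne_zero (mul_ne_zero size_ne_zero linear_ne_zero)
    (prod_add_five_ne_zero D t _)) (mul_ne_zero (by simp) (prod_add_three_ne_zero D t _))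

theorem isParameterMatrix_paramMatrix (D : ℕ) :
    UniformGraph.IsParameterMatrix (paramMatrix D) where
  tridiagonal i j h := by
    simp only [paramMatrix, UniformGraph.tridiagonal, Matrix.of_apply]
    rw [if_neg (by omega), if_neg (by omega), if_neg (by omega)]
  diag i := by simp [paramMatrix, UniformGraph.tridiagonal]
  offDiag := Or.inl fun i h2 hi => by
    rw [eMinus_paramMatrix]
    exact eMinus_ne_zero h2 hi
  nonsingular _ _ := det_principalSubmatrix_paramMatrix_ne_zero

end HalvedCube

section Sl2

variable {R L M : Type*} [CommRing R] [LieRing L] [AddCommGroup M] [Module R M]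
  [LieRingModule L M] {h e f : L} {μ : R} {v : M}

theorem lie_e_lie_f_eq (t : IsSl2Triple h e f) (hv : ⁅h, v⁆ = μ • v) :
    ⁅e, ⁅f, v⁆⁆ = ⁅f, ⁅e, v⁆⁆ + μ • v := by
  rw [leibniz_lie, t.lie_e_f, hv, add_comm]

variable [LieAlgebra R L] [LieModule R L M]

theorem lie_h_lie_e_eq_smul (t : IsSl2Triple h e f) (hv : ⁅h, v⁆ = μ • v) :
    ⁅h, ⁅e, v⁆⁆ = (μ + 2) • ⁅e, v⁆ := by
  rw [leibniz_lie, t.lie_h_e_smul R, hv, lie_smul, smul_lie]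
  module

theorem lie_h_lie_f_eq_smul (t : IsSl2Triple h e f) (hv : ⁅h, v⁆ = μ • v) :
    ⁅h, ⁅f, v⁆⁆ = (μ - 2) • ⁅f, v⁆ := by
  rw [leibniz_lie, t.lie_lie_smul_f R, hv, lie_smul, neg_lie, smul_lie]
  module

theorem lie_e_lie_f_lie_f_eq (t : IsSl2Triple h e f) (hv : ⁅h, v⁆ = μ • v) :
    ⁅e, ⁅f, ⁅f, v⁆⁆⁆ = ⁅f, ⁅f, ⁅e, v⁆⁆⁆ + (2 * μ - 2) • ⁅f, v⁆ := by
  rw [lie_e_lie_f_eq t (lie_h_lie_f_eq_smul t hv), lie_e_lie_f_eq t hv, lie_add, lie_smul]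
  module

theorem lie_e_lie_e_lie_f_eq (t : IsSl2Triple h e f) (hv : ⁅h, v⁆ = μ • v) :
    ⁅e, ⁅e, ⁅f, v⁆⁆⁆ = ⁅f, ⁅e, ⁅e, v⁆⁆⁆ + (2 * μ + 2) • ⁅e, v⁆ := by
  rw [lie_e_lie_f_eq t hv, lie_add, lie_smul, lie_e_lie_f_eq t (lie_h_lie_e_eq_smul t hv)]
  module

theorem lie_e_lie_e_lie_f_lie_f_eq (t : IsSl2Triple h e f) (hv : ⁅h, v⁆ = μ • v) :
    ⁅e, ⁅e, ⁅f, ⁅f, v⁆⁆⁆⁆ =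
      ⁅f, ⁅f, ⁅e, ⁅e, v⁆⁆⁆⁆ + (4 * μ) • ⁅f, ⁅e, v⁆⁆ + (2 * μ * (μ - 1)) • v := by
  rw [lie_e_lie_f_lie_f_eq t hv, lie_add, lie_smul,
    lie_e_lie_f_lie_f_eq t (lie_h_lie_e_eq_smul t hv), lie_e_lie_f_eq t hv]
  module

/-- Both `e²f²(e²v)` and `e²(e²f²v)` expand into `f²e⁴v`, `fe³v` and `e²v`; the coefficients are
chosen so that `f²e⁴v` and `fe³v` cancel. -/
theorem sl2_uniform_relation (t : IsSl2Triple h e f) (hv : ⁅h, v⁆ = μ • v) :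
    (2 * (μ + 2)) • ⁅e, ⁅e, ⁅f, ⁅f, ⁅e, ⁅e, v⁆⁆⁆⁆⁆⁆ =
      μ • ⁅f, ⁅f, ⁅e, ⁅e, ⁅e, ⁅e, v⁆⁆⁆⁆⁆⁆ + (μ + 4) • ⁅e, ⁅e, ⁅e, ⁅e, ⁅f, ⁅f, v⁆⁆⁆⁆⁆⁆ -
        (8 * μ * (μ + 2) * (μ + 4)) • ⁅e, ⁅e, v⁆⁆ := by
  have hev := lie_h_lie_e_eq_smul t hv
  have heev := lie_h_lie_e_eq_smul t hev
  rw [lie_e_lie_e_lie_f_lie_f_eq t heev, lie_e_lie_e_lie_f_lie_f_eq t hv]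
  simp only [lie_add, lie_smul]
  rw [lie_e_lie_e_lie_f_lie_f_eq t heev, lie_e_lie_e_lie_f_eq t hev]
  module

end Sl2

namespace BooleanLattice

attribute [local instance] LieRing.ofAssociativeRing LieAlgebra.ofAssociativeAlgebra

variable {R α : Type*} [CommRing R]

section CardWeight

variable [Fintype α]

/-- The Cartan element of the `sl₂`-triple formed with `low` and `up`: a set `S` has weight
`|α| - 2 |S|`. -/
def cardWeight : Module.End R (Finset α → R) where
  toFun w S := (Fintype.card α - 2 * S.card) * w S
  map_add' v w := by ext S; simp [mul_add]
  map_smul' c w := by ext S; simp [mul_left_comm]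

theorem cardWeight_apply (w : Finset α → R) (S : Finset α) :
    cardWeight w S = (Fintype.card α - 2 * S.card) * w S := rfl

theorem eq_zero_of_cardWeight_eq [CharZero R] [NoZeroDivisors R] {w : Finset α → R} {k : ℤ}
    (hw : cardWeight w = ((Fintype.card α : R) - 2 * k) • w) (hk : k < 0 ∨ Fintype.card α < k) :
    w = 0 := by
  ext S
  have card_le := Finset.card_le_univ S
  have card_ne : (S.card : R) - k ≠ 0 := by
    rw [sub_ne_zero]
    exact_mod_cast (by omega : (S.card : ℤ) ≠ k)
  have h := congrFun hw S
  rw [cardWeight_apply, Pi.smul_apply, smul_eq_mul] at h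
  have key : (2 * ((S.card : R) - k)) * w S = 0 := by linear_combination -h
  exact (mul_eq_zero.1 key).resolve_left (mul_ne_zero two_ne_zero card_ne)

theorem cardWeight_eq_smul_of_card {w : Finset α → R} {k : ℕ}
    (hw : ∀ S, S.card ≠ k → w S = 0) : cardWeight w = ((Fintype.card α : R) - 2 * k) • w := by
  ext S
  rw [cardWeight_apply, Pi.smul_apply, smul_eq_mul]
  by_cases hS : S.card = k
  · rw [hS]
  · rw [hw S hS, mul_zero, mul_zero]

end CardWeight

theorem covBy_iff_subset_and_card {S T : Finset α} :
    T ⋖ S ↔ T ⊆ S ∧ S.card = T.card + 1 := by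
  classical
  rw [Finset.covBy_iff_card_sdiff_eq_one]
  refine and_congr_right fun hTS => ?_
  have card_sdiff := Finset.card_sdiff_add_card_eq_card hTS
  omega

variable [DecidableEq α]

/-- The raising operator of the Boolean lattice. -/
def up : Module.End R (Finset α → R) where
  toFun w S := ∑ a ∈ S, w (S.erase a)
  map_add' v w := by ext S; simp [Finset.sum_add_distrib]
  map_smul' c w := by ext S; simp [Finset.mul_sum]

theorem up_apply (w : Finset α → R) (S : Finset α) : up w S = ∑ a ∈ S, w (S.erase a) := rfl

theorem covBy_and_covBy_iff {S T U : Finset α} :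
    T ⋖ U ∧ U ⋖ S ↔ U ∈ Finset.Ioo T S ∧ S.card = T.card + 2 := by
  rw [Finset.mem_Ioo]
  constructor
  · rintro ⟨hTU, hUS⟩
    have hT := (covBy_iff_subset_and_card.1 hTU).2
    have hS := (covBy_iff_subset_and_card.1 hUS).2
    exact ⟨⟨hTU.lt, hUS.lt⟩, by omega⟩
  · rintro ⟨⟨hTU, hUS⟩, hcard⟩
    have hT := Finset.card_lt_card hTU
    have hS := Finset.card_lt_card hUS
    exact ⟨covBy_iff_subset_and_card.2 ⟨hTU.le, by omega⟩,
      covBy_iff_subset_and_card.2 ⟨hUS.le, by omega⟩⟩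

variable [Fintype α]

/-- The lowering operator of the Boolean lattice. -/
def low : Module.End R (Finset α → R) where
  toFun w S := ∑ a ∈ Sᶜ, w (insert a S)
  map_add' v w := by ext S; simp [Finset.sum_add_distrib]
  map_smul' c w := by ext S; simp [Finset.mul_sum]

theorem low_apply (w : Finset α → R) (S : Finset α) : low w S = ∑ a ∈ Sᶜ, w (insert a S) := rfl

theorem low_up_apply (w : Finset α → R) (S : Finset α) :
    low (up w) S = Sᶜ.card * w S + ∑ a ∈ Sᶜ, ∑ b ∈ S, w ((insert a S).erase b) := by
  rw [low_apply, ← nsmul_eq_mul, ← Finset.sum_const, ← Finset.sum_add_distrib]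
  refine Finset.sum_congr rfl fun a ha => ?_
  have ha := Finset.mem_compl.1 ha
  rw [up_apply, Finset.sum_insert ha, Finset.erase_insert ha]

theorem up_low_apply (w : Finset α → R) (S : Finset α) :
    up (low w) S = S.card * w S + ∑ b ∈ S, ∑ a ∈ Sᶜ, w ((insert a S).erase b) := by
  rw [up_apply, ← nsmul_eq_mul, ← Finset.sum_const, ← Finset.sum_add_distrib]
  refine Finset.sum_congr rfl fun b hb => ?_
  rw [low_apply, Finset.compl_erase, Finset.sum_insert (by simpa using hb), Finset.insert_erase hb]
  congr 1
  refine Finset.sum_congr rfl fun a ha => ?_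
  have a_ne_b : a ≠ b := fun hab => Finset.mem_compl.1 ha (hab ▸ hb)
  rw [Finset.erase_insert_of_ne a_ne_b]

theorem lie_low_up :
    ⁅(low : Module.End R (Finset α → R)), (up : Module.End R (Finset α → R))⁆ = cardWeight := by
  refine LinearMap.ext fun w => funext fun S => ?_
  rw [Ring.lie_def, LinearMap.sub_apply, Module.End.mul_apply, Module.End.mul_apply, Pi.sub_apply,
    low_up_apply, up_low_apply, cardWeight_apply, Finset.sum_comm, Finset.card_compl,
    Nat.cast_sub (Finset.card_le_univ S)]
  ring

theorem lie_cardWeight_low :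
    ⁅(cardWeight : Module.End R (Finset α → R)), (low : Module.End R (Finset α → R))⁆ =
      2 • low := by
  refine LinearMap.ext fun w => funext fun S => ?_
  rw [Ring.lie_def, LinearMap.sub_apply, Module.End.mul_apply, Module.End.mul_apply, Pi.sub_apply,
    LinearMap.smul_apply, Pi.smul_apply, cardWeight_apply, low_apply, low_apply, Finset.mul_sum,
    Finset.smul_sum, ← Finset.sum_sub_distrib]
  refine Finset.sum_congr rfl fun a ha => ?_
  rw [cardWeight_apply, Finset.card_insert_of_notMem (Finset.mem_compl.1 ha)]
  push_cast
  ring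

theorem lie_cardWeight_up :
    ⁅(cardWeight : Module.End R (Finset α → R)), (up : Module.End R (Finset α → R))⁆ =
      -(2 • up) := by
  refine LinearMap.ext fun w => funext fun S => ?_
  rw [Ring.lie_def, LinearMap.sub_apply, Module.End.mul_apply, Module.End.mul_apply, Pi.sub_apply,
    LinearMap.neg_apply, Pi.neg_apply, LinearMap.smul_apply, Pi.smul_apply, cardWeight_apply,
    up_apply, up_apply, Finset.mul_sum, Finset.smul_sum, ← Finset.sum_sub_distrib,
    ← Finset.sum_neg_distrib]
  refine Finset.sum_congr rfl fun a ha => ?_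
  rw [cardWeight_apply, ← Finset.card_erase_add_one ha]
  push_cast
  ring

theorem cardWeight_low {μ : R} {w : Finset α → R} (hw : cardWeight w = μ • w) :
    cardWeight (low w) = (μ + 2) • low w := by
  have commutator := LinearMap.congr_fun (lie_cardWeight_low (R := R) (α := α)) w
  rw [Ring.lie_def, LinearMap.sub_apply, Module.End.mul_apply, Module.End.mul_apply, hw, map_smul,
    LinearMap.smul_apply] at commutator
  linear_combination (norm := module) commutator

theorem cardWeight_up {μ : R} {w : Finset α → R} (hw : cardWeight w = μ • w) :
    cardWeight (up w) = (μ - 2) • up w := by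
  have commutator := LinearMap.congr_fun (lie_cardWeight_up (R := R) (α := α)) w
  rw [Ring.lie_def, LinearMap.sub_apply, Module.End.mul_apply, Module.End.mul_apply, hw, map_smul,
    LinearMap.neg_apply, LinearMap.smul_apply] at commutator
  linear_combination (norm := module) commutator

theorem isSl2Triple [CharZero R] [Nonempty α] :
    IsSl2Triple (cardWeight : Module.End R (Finset α → R)) low up where
  h_ne_zero h := by
    have weight_empty := congrFun (LinearMap.congr_fun h 1) ∅
    simp [cardWeight_apply] at weight_empty
  lie_e_f := lie_low_up
  lie_h_e_nsmul := lie_cardWeight_low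
  lie_h_f_nsmul := lie_cardWeight_up

open scoped Classical in
theorem up_apply_eq_sum_covBy (w : Finset α → R) (S : Finset α) :
    up w S = ∑ T with T ⋖ S, w T := by
  have image_erase : ({T | T ⋖ S} : Finset (Finset α)) = S.image S.erase := by
    ext T
    simp [Finset.covBy_iff_exists_erase]
  rw [image_erase, Finset.sum_image (Finset.erase_injOn S), up_apply]

open scoped Classical in
theorem low_apply_eq_sum_covBy (w : Finset α → R) (T : Finset α) :
    low w T = ∑ S with T ⋖ S, w S := by
  have image_insert : ({S | T ⋖ S} : Finset (Finset α)) = Tᶜ.image (insert · T) := by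
    ext S
    simp [Finset.covBy_iff_exists_insert]
  rw [image_insert, Finset.sum_image (Finset.insert_inj_on' T), low_apply]

open scoped Classical in
theorem card_filter_covBy_and_covBy (T S : Finset α) :
    Finset.card {U | T ⋖ U ∧ U ⋖ S} = if T ⊆ S ∧ S.card = T.card + 2 then 2 else 0 := by
  simp only [covBy_and_covBy_iff]
  split_ifs with h
  · simp [h.2, -Finset.mem_Ioo, Finset.card_Ioo_finset h.1]
  · refine Finset.card_eq_zero.2 (Finset.filter_eq_empty_iff.2 fun U _ ⟨hU, hcard⟩ => h ⟨?_, hcard⟩)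
    exact ((Finset.mem_Ioo.1 hU).1.trans (Finset.mem_Ioo.1 hU).2).le

theorem up_up_apply (w : Finset α → R) (S : Finset α) :
    up (up w) S = 2 * ∑ T with T ⊆ S ∧ S.card = T.card + 2, w T := by
  classical
  calc up (up w) S = ∑ U with U ⋖ S, ∑ T with T ⋖ U, w T := by
        simp only [up_apply_eq_sum_covBy]
    _ = ∑ T, ∑ U with T ⋖ U ∧ U ⋖ S, w T := Finset.sum_comm' (by simp [and_comm])
    _ = 2 * ∑ T with T ⊆ S ∧ S.card = T.card + 2, w T := by
        simp [card_filter_covBy_and_covBy, Finset.mul_sum, Finset.sum_filter]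

theorem low_low_apply (w : Finset α → R) (T : Finset α) :
    low (low w) T = 2 * ∑ S with T ⊆ S ∧ S.card = T.card + 2, w S := by
  classical
  calc low (low w) T = ∑ U with T ⋖ U, ∑ S with U ⋖ S, w S := by
        simp only [low_apply_eq_sum_covBy]
    _ = ∑ S, ∑ U with T ⋖ U ∧ U ⋖ S, w S := Finset.sum_comm' (by simp)
    _ = 2 * ∑ S with T ⊆ S ∧ S.card = T.card + 2, w S := by
        simp [card_filter_covBy_and_covBy, Finset.mul_sum, Finset.sum_filter]

theorem low_up_relation [CharZero R] [Nonempty α] {μ : R} {w : Finset α → R}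
    (hw : cardWeight w = μ • w) :
    (2 * (μ + 2)) • low (low (up (up (low (low w))))) =
      μ • up (up (low (low (low (low w))))) + (μ + 4) • low (low (low (low (up (up w))))) -
        (8 * μ * (μ + 2) * (μ + 4)) • low (low w) :=
  sl2_uniform_relation (isSl2Triple (R := R) (α := α)) (v := w) hw

end BooleanLattice

namespace UniformGraph

variable {X : Type*} {G : SimpleGraph X} {x : X}

section Finite

variable [Finite X]

theorem eccent_ne_top (hG : G.Connected) (x : X) : G.eccent x ≠ ⊤ := by
  have : Nonempty X := ⟨x⟩
  obtain ⟨y, hy⟩ := G.exists_edist_eq_eccent_of_finite x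
  rw [← hy]
  exact SimpleGraph.edist_ne_top_iff_reachable.2 (hG x y)

theorem dist_le_ecc (hG : G.Connected) (x y : X) : G.dist x y ≤ ecc G x :=
  ENat.toNat_le_toNat SimpleGraph.edist_le_eccent (eccent_ne_top hG x)

theorem exists_dist_eq_ecc (G : SimpleGraph X) (x : X) : ∃ y, G.dist x y = ecc G x := by
  have : Nonempty X := ⟨x⟩
  obtain ⟨y, hy⟩ := G.exists_edist_eq_eccent_of_finite x
  exact ⟨y, congrArg ENat.toNat hy⟩

theorem ecc_eq_of_forall_dist_le {d : ℕ} (hG : G.Connected) (dist_le : ∀ y, G.dist x y ≤ d)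
    (exists_dist_eq : ∃ y, G.dist x y = d) : ecc G x = d := by
  obtain ⟨y, hy⟩ := exists_dist_eq_ecc G x
  obtain ⟨z, hz⟩ := exists_dist_eq
  exact le_antisymm (hy ▸ dist_le y) (hz ▸ dist_le_ecc hG x z)

end Finite

section Operators

variable [Fintype X] [DecidableEq X]

theorem eq_zero_of_mem_subconstituent {i : ℕ} {v : X → ℂ} (hv : v ∈ subconstituent G x i) {y : X}
    (hy : G.dist x y ≠ i) : v y = 0 := by
  obtain ⟨u, rfl⟩ := hv
  simp [dualIdempotent, Matrix.mulVec_diagonal, hy]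

theorem raising_eq_transpose_lowering (G : SimpleGraph X) (x : X) :
    raising G x = (lowering G x)ᵀ := by
  simp only [raising, lowering, adj, dualIdempotent, Matrix.transpose_sum, Matrix.transpose_mul,
    Matrix.diagonal_transpose, SimpleGraph.transpose_adjMatrix, Matrix.mul_assoc]
  refine Finset.sum_nbij' (· + 1) (· - 1) ?_ ?_ ?_ ?_ fun i _ => ?_
  · simp
  · grind
  · simp
  · grind
  · rw [Nat.add_sub_cancel]

open scoped Classical in
theorem lowering_apply (hG : G.Connected) (x y z : X) :
    lowering G x y z = if G.Adj y z ∧ G.dist x z = G.dist x y + 1 then 1 else 0 := by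
  have dist_le := dist_le_ecc hG x z
  have summand_apply (i : ℕ) :
      (dualIdempotent G x (i - 1) * adj G * dualIdempotent G x i) y z =
        if G.dist x z = i then if G.Adj y z ∧ G.dist x y = i - 1 then 1 else 0 else 0 := by
    simp only [dualIdempotent, adj, Matrix.mul_diagonal, Matrix.diagonal_mul,
      SimpleGraph.adjMatrix_apply, mul_ite, mul_one, mul_zero, ite_and]
  simp_rw [lowering, Matrix.sum_apply, summand_apply]
  rw [Finset.sum_ite_eq, ← ite_and]
  exact if_congr (by grind) rfl rfl

open scoped Classical in
theorem raising_apply (hG : G.Connected) (x y z : X) :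
    raising G x y z = if G.Adj y z ∧ G.dist x y = G.dist x z + 1 then 1 else 0 := by
  rw [raising_eq_transpose_lowering, Matrix.transpose_apply, lowering_apply hG, G.adj_comm]

end Operators

section FlatFree

theorem flatFree_adj {y z : X} :
    (flatFree G x).Adj y z ↔ G.Adj y z ∧ G.dist x y ≠ G.dist x z := Iff.rfl

theorem flatFree_le (G : SimpleGraph X) (x : X) : flatFree G x ≤ G := fun _ _ h => h.1

theorem exists_adj_dist_eq {k : ℕ} {y : X} (hG : G.Connected) (hy : G.dist x y = k + 1) :
    ∃ z, G.Adj z y ∧ G.dist x z = k := by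
  obtain ⟨p, hp⟩ := hG.exists_walk_length_eq_dist y x
  rw [SimpleGraph.dist_comm, hy] at hp
  cases p with
  | nil => simp at hp
  | @cons _ z _ hyz q =>
    have dist_le : G.dist z x ≤ k :=
      (SimpleGraph.dist_le q).trans (by simpa using hp.le)
    rw [SimpleGraph.dist_comm] at dist_le
    have dist_step := hyz.diff_dist_adj (u := x)
    exact ⟨z, hyz.symm, by omega⟩

theorem exists_walk_flatFree (hG : G.Connected) (x : X) (k : ℕ) :
    ∀ y, G.dist x y = k → ∃ p : (flatFree G x).Walk x y, p.length = k := by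
  induction k with
  | zero =>
    intro y hy
    obtain rfl := hG.dist_eq_zero_iff.1 hy
    exact ⟨.nil, rfl⟩
  | succ k ih =>
    intro y hy
    obtain ⟨z, hzy, hz⟩ := exists_adj_dist_eq hG hy
    obtain ⟨p, hp⟩ := ih z hz
    have hzy' : (flatFree G x).Adj z y := ⟨hzy, by omega⟩
    exact ⟨p.concat hzy', by rw [SimpleGraph.Walk.length_concat, hp]⟩

theorem connected_flatFree (hG : G.Connected) (x : X) : (flatFree G x).Connected := by
  have : Nonempty X := ⟨x⟩
  refine SimpleGraph.Connected.mk fun y z => ?_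
  obtain ⟨p, -⟩ := exists_walk_flatFree hG x _ y rfl
  obtain ⟨q, -⟩ := exists_walk_flatFree hG x _ z rfl
  exact ⟨p.reverse.append q⟩

theorem dist_flatFree (hG : G.Connected) (x y : X) :
    (flatFree G x).dist x y = G.dist x y := by
  obtain ⟨p, hp⟩ := exists_walk_flatFree hG x _ y rfl
  refine le_antisymm (hp ▸ SimpleGraph.dist_le p) ?_
  exact (connected_flatFree hG x x y).dist_anti (flatFree_le G x)

theorem isBipartite_flatFree (G : SimpleGraph X) (x : X) : (flatFree G x).IsBipartite := by
  refine ⟨SimpleGraph.Coloring.mk (fun y => Fin.ofNat 2 (G.dist x y)) fun {y z} h hcolor => ?_⟩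
  have hdist := h.2
  have hdiff := h.1.diff_dist_adj (u := x)
  have hmod := congrArg Fin.val hcolor
  simp only [Fin.val_ofNat] at hmod
  omega

theorem ecc_flatFree [Finite X] (hG : G.Connected) (x : X) : ecc (flatFree G x) x = ecc G x := by
  refine ecc_eq_of_forall_dist_le (connected_flatFree hG x) ?_ ?_ <;> simp only [dist_flatFree hG]
  · exact dist_le_ecc hG x
  · exact exists_dist_eq_ecc G x

variable [Fintype X] [DecidableEq X]

theorem lowering_flatFree (hG : G.Connected) (x : X) :
    lowering (flatFree G x) x = lowering G x := by
  classical
  ext y z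
  rw [lowering_apply hG, lowering_apply (connected_flatFree hG x)]
  refine if_congr ?_ rfl rfl
  rw [dist_flatFree hG, dist_flatFree hG, flatFree_adj]
  exact ⟨fun h => ⟨h.1.1, h.2⟩, fun h => ⟨⟨h.1, by omega⟩, h.2⟩⟩

theorem uniformRelationOn_flatFree (hG : G.Connected) {i : ℕ} {a b c : ℂ} :
    UniformRelationOn (flatFree G x) x i a b c ↔ UniformRelationOn G x i a b c := by
  simp only [UniformRelationOn, raising_eq_transpose_lowering, lowering_flatFree hG,
    subconstituent, dualIdempotent, dist_flatFree hG]

end FlatFree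

end UniformGraph

namespace HalvedCube

open BooleanLattice

section DiffSet

variable {n : ℕ}

/-- The set of positions in which two vertices differ. For a fixed vertex `x`, the map `diffSet x`
identifies the vertices with the subsets of `Fin n` of even size. -/
def diffSet (y z : Vertex n) : Finset (Fin n) := {a | y.1 a ≠ z.1 a}

theorem card_diffSet (y z : Vertex n) : (diffSet y z).card = hammingDist y.1 z.1 := rfl

theorem graph_adj {y z : Vertex n} : (graph n).Adj y z ↔ (diffSet y z).card = 2 := Iff.rfl

theorem symmDiff_diffSet (x y z : Vertex n) :
    symmDiff (diffSet x y) (diffSet x z) = diffSet y z := by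
  have differ_iff : ∀ p q r : ZMod 2, (p ≠ q ∧ p = r ∨ p ≠ r ∧ p = q) ↔ q ≠ r := by decide
  ext a
  simpa [diffSet, Finset.mem_symmDiff] using differ_iff (x.1 a) (y.1 a) (z.1 a)

theorem card_diffSet_eq_zero {y z : Vertex n} : (diffSet y z).card = 0 ↔ y = z := by
  rw [card_diffSet, hammingDist_eq_zero, Subtype.ext_iff]

theorem diffSet_injective (x : Vertex n) : Function.Injective (diffSet x) := fun y z h => by
  rw [← card_diffSet_eq_zero, ← symmDiff_diffSet x, h, symmDiff_self, Finset.bot_eq_empty,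
    Finset.card_empty]

theorem even_hammingNorm_iff (v : Fin n → ZMod 2) : Even (hammingNorm v) ↔ ∑ a, v a = 0 := by
  have indicator_eq : ∀ p : ZMod 2, (if p ≠ 0 then 1 else 0) = p := by decide
  rw [← ZMod.natCast_eq_zero_iff_even, hammingNorm, ← Finset.sum_boole]
  simp_rw [indicator_eq]

theorem even_card_diffSet (y z : Vertex n) : Even (diffSet y z).card := by
  rw [card_diffSet, hammingDist_eq_hammingNorm, even_hammingNorm_iff]
  simp [Finset.sum_add_distrib, (even_hammingNorm_iff _).1 y.2, (even_hammingNorm_iff _).1 z.2]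

theorem exists_diffSet_eq (x : Vertex n) {S : Finset (Fin n)} (hS : Even S.card) :
    ∃ y, diffSet x y = S := by
  refine ⟨⟨fun a => x.1 a + if a ∈ S then 1 else 0, ?_⟩, ?_⟩
  · rw [even_hammingNorm_iff, Finset.sum_add_distrib, (even_hammingNorm_iff _).1 x.2, zero_add,
      Finset.sum_boole, Finset.filter_univ_mem, ZMod.natCast_eq_zero_iff_even]
    exact hS
  · ext a
    simp [diffSet]

theorem sum_comp_diffSet {M : Type*} [AddCommMonoid M] (x : Vertex n) {g : Finset (Fin n) → M}
    (hg : ∀ S, Odd S.card → g S = 0) : ∑ y, g (diffSet x y) = ∑ S, g S := by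
  refine Fintype.sum_of_injective _ (diffSet_injective x) _ _ (fun S hS => hg S ?_) fun _ => rfl
  exact Nat.not_even_iff_odd.1 fun even_card => hS (exists_diffSet_eq x even_card)

end DiffSet

section Metric

variable {n : ℕ}

theorem exists_walk_length_eq (k : ℕ) :
    ∀ y z : Vertex n, (diffSet y z).card = 2 * k → ∃ p : (graph n).Walk y z, p.length = k := by
  induction k with
  | zero =>
    intro y z h
    obtain rfl := card_diffSet_eq_zero.1 h
    exact ⟨.nil, rfl⟩
  | succ k ih =>
    intro y z h
    obtain ⟨P, hP, card_P⟩ := Finset.exists_subset_card_eq (show 2 ≤ (diffSet y z).card by omega)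
    obtain ⟨u, rfl⟩ := exists_diffSet_eq y (S := P) (by rw [card_P]; exact even_two)
    have card_uz : (diffSet u z).card = 2 * k := by
      rw [← symmDiff_diffSet y, symmDiff_of_le hP, Finset.card_sdiff_of_subset hP]
      omega
    obtain ⟨p, hp⟩ := ih u z card_uz
    exact ⟨.cons (graph_adj.2 card_P) p, by rw [SimpleGraph.Walk.length_cons, hp]⟩

theorem card_diffSet_le_of_walk {y z : Vertex n} (p : (graph n).Walk y z) :
    (diffSet y z).card ≤ 2 * p.length := by
  induction p with
  | nil => simp [diffSet]
  | @cons u v w h p ih =>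
    have triangle := hammingDist_triangle u.1 v.1 w.1
    have card_uv := graph_adj.1 h
    simp only [card_diffSet, SimpleGraph.Walk.length_cons] at *
    omega

theorem connected_graph (n : ℕ) : (graph n).Connected := by
  have : Nonempty (Vertex n) := ⟨⟨0, by simp⟩⟩
  refine SimpleGraph.Connected.mk fun y z => ?_
  obtain ⟨k, hk⟩ := (even_card_diffSet y z).two_dvd
  obtain ⟨p, -⟩ := exists_walk_length_eq k y z hk
  exact ⟨p⟩

theorem two_mul_dist (y z : Vertex n) : 2 * (graph n).dist y z = (diffSet y z).card := by
  obtain ⟨k, hk⟩ := (even_card_diffSet y z).two_dvd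
  obtain ⟨p, hp⟩ := exists_walk_length_eq k y z hk
  obtain ⟨q, hq⟩ := (connected_graph n).exists_walk_length_eq_dist y z
  have card_le := card_diffSet_le_of_walk q
  have dist_le := SimpleGraph.dist_le p
  omega

theorem dist_le_half (y z : Vertex n) : (graph n).dist y z ≤ n / 2 := by
  have card_le := Finset.card_le_univ (diffSet y z)
  rw [← two_mul_dist, Fintype.card_fin] at card_le
  omega

theorem exists_dist_eq_half (x : Vertex n) : ∃ y, (graph n).dist x y = n / 2 := by
  obtain ⟨P, -, card_P⟩ := Finset.exists_subset_card_eq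
    (show 2 * (n / 2) ≤ (Finset.univ : Finset (Fin n)).card by
      rw [Finset.card_univ, Fintype.card_fin]; omega)
  obtain ⟨y, rfl⟩ := exists_diffSet_eq x (S := P) (card_P ▸ even_two_mul _)
  exact ⟨y, by rw [← two_mul_dist] at card_P; omega⟩

theorem diam_graph (n : ℕ) : (graph n).diam = n / 2 := by
  have : Nonempty (Vertex n) := (connected_graph n).nonempty
  obtain ⟨y, z, hyz⟩ := (graph n).exists_dist_eq_diam
  obtain ⟨u, hu⟩ := exists_dist_eq_half y
  refine le_antisymm (hyz ▸ dist_le_half y z) (hu ▸ SimpleGraph.dist_le_diam ?_)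
  exact SimpleGraph.connected_iff_ediam_ne_top.1 (connected_graph n)

theorem ecc_graph (x : Vertex n) : UniformGraph.ecc (graph n) x = n / 2 :=
  UniformGraph.ecc_eq_of_forall_dist_le (connected_graph n) (dist_le_half x)
    (exists_dist_eq_half x)

theorem not_isBipartite_graph (hn : 3 ≤ n) : ¬ (graph n).IsBipartite := by
  intro bipartite
  obtain ⟨x⟩ := (connected_graph n).nonempty
  obtain ⟨P, -, card_P⟩ := Finset.exists_subset_card_eq
    (show 3 ≤ (Finset.univ : Finset (Fin n)).card by simpa using hn)
  obtain ⟨a, b, c, hab, hac, hbc, -⟩ := Finset.card_eq_three.1 card_P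
  obtain ⟨y, hy⟩ := exists_diffSet_eq x (S := {a, b}) (by rw [Finset.card_pair hab]; exact even_two)
  obtain ⟨z, hz⟩ := exists_diffSet_eq x (S := {a, c}) (by rw [Finset.card_pair hac]; exact even_two)
  have diffSet_yz : diffSet y z = {b, c} := by
    rw [← symmDiff_diffSet x, hy, hz]
    grind [Finset.mem_symmDiff]
  have triangle : (graph n).IsNClique 3 {x, y, z} := by
    rw [SimpleGraph.is3Clique_triple_iff, graph_adj, graph_adj, graph_adj, hy, hz, diffSet_yz]
    exact ⟨Finset.card_pair hab, Finset.card_pair hac, Finset.card_pair hbc⟩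
  exact bipartite.cliqueFree (by norm_num) _ triangle

end Metric

section UniformRelation

theorem adj_and_dist_eq_add_one_iff {n : ℕ} (x y z : Vertex n) :
    (graph n).Adj y z ∧ (graph n).dist x z = (graph n).dist x y + 1 ↔
      diffSet x y ⊆ diffSet x z ∧ (diffSet x z).card = (diffSet x y).card + 2 := by
  have card_xy := two_mul_dist x y
  have card_xz := two_mul_dist x z
  have card_yz : (diffSet y z).card =
      (diffSet x y \ diffSet x z).card + (diffSet x z \ diffSet x y).card := by
    rw [← symmDiff_diffSet x, symmDiff_def, Finset.sup_eq_union,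
      Finset.card_union_of_disjoint disjoint_sdiff_sdiff]
  have card_sdiff_comm := Finset.card_sdiff_add_card (diffSet x y) (diffSet x z)
  have card_sdiff_comm' := Finset.card_sdiff_add_card (diffSet x z) (diffSet x y)
  rw [Finset.union_comm] at card_sdiff_comm'
  rw [graph_adj, ← Finset.sdiff_eq_empty_iff_subset, ← Finset.card_eq_zero]
  omega

variable {n : ℕ}

theorem lowering_mulVec (x : Vertex n) (w : Finset (Fin n) → ℂ) :
    UniformGraph.lowering (graph n) x *ᵥ (w ∘ diffSet x) =
      ((1 / 2 : ℂ) • low (low w)) ∘ diffSet x := by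
  classical
  ext y
  simp_rw [Function.comp_apply, Pi.smul_apply, low_low_apply, Matrix.mulVec, dotProduct,
    UniformGraph.lowering_apply (connected_graph n), adj_and_dist_eq_add_one_iff]
  rw [smul_eq_mul, one_div, inv_mul_cancel_left₀ two_ne_zero, Finset.sum_filter,
    ← sum_comp_diffSet x]
  · simp
  · intro S odd_card
    have even_card := even_card_diffSet x y
    grind

theorem raising_mulVec (x : Vertex n) (w : Finset (Fin n) → ℂ) :
    UniformGraph.raising (graph n) x *ᵥ (w ∘ diffSet x) =
      ((1 / 2 : ℂ) • up (up w)) ∘ diffSet x := by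
  classical
  ext y
  simp_rw [Function.comp_apply, Pi.smul_apply, up_up_apply, Matrix.mulVec, dotProduct,
    UniformGraph.raising_apply (connected_graph n), (graph n).adj_comm y,
    adj_and_dist_eq_add_one_iff]
  rw [smul_eq_mul, one_div, inv_mul_cancel_left₀ two_ne_zero, Finset.sum_filter,
    ← sum_comp_diffSet x]
  · simp
  · intro S odd_card
    have even_card := even_card_diffSet x y
    grind

theorem exists_cardWeight_eq_and_comp_diffSet {x : Vertex n} {i : ℕ} {v : Vertex n → ℂ}
    (hv : v ∈ UniformGraph.subconstituent (graph n) x i) :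
    ∃ w : Finset (Fin n) → ℂ, cardWeight w = ((n : ℂ) - 4 * i) • w ∧ w ∘ diffSet x = v := by
  refine ⟨Function.extend (diffSet x) v 0, ?_, Function.extend_comp (diffSet_injective x) v 0⟩
  have extend_eq_zero (S : Finset (Fin n)) (hS : S.card ≠ 2 * i) :
      Function.extend (diffSet x) v 0 S = 0 := by
    by_cases h : ∃ y, diffSet x y = S
    · obtain ⟨y, rfl⟩ := h
      rw [(diffSet_injective x).extend_apply]
      refine UniformGraph.eq_zero_of_mem_subconstituent hv fun hy => hS ?_
      rw [← two_mul_dist, hy]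
    · rw [Function.extend_apply' _ _ _ h, Pi.zero_apply]
  rw [cardWeight_eq_smul_of_card extend_eq_zero, Fintype.card_fin]
  push_cast
  ring_nf

theorem uniform_relation_low_up {D i : ℕ} (h1 : 1 ≤ i) (hi : i ≤ D)
    {w : Finset (Fin (2 * D + 1)) → ℂ}
    (hw : cardWeight w = (((2 * D + 1 : ℕ) : ℂ) - 4 * i) • w) :
    eMinus D i • up (up (low (low (low (low w))))) + low (low (up (up (low (low w))))) +
      ePlus D i • low (low (low (low (up (up w))))) = (4 * fCoeff D i) • low (low w) := by
  have minus_term : ((6 - 8 * (i : ℂ) + 4 * (D : ℂ)) * eMinus D i) •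
      up (up (low (low (low (low w))))) =
        (4 * (i : ℂ) - 1 - 2 * D) • up (up (low (low (low (low w))))) := by
    rcases h1.eq_or_lt with rfl | h2
    · have low_pow_four : low (low (low (low w))) = 0 := by
        refine eq_zero_of_cardWeight_eq (k := -2) ?_ (Or.inl (by norm_num))
        rw [cardWeight_low (cardWeight_low (cardWeight_low (cardWeight_low hw))),
          Fintype.card_fin]
        push_cast
        ring_nf
      rw [low_pow_four, map_zero, map_zero, smul_zero, smul_zero]
    · rw [denominator_mul_eMinus h2 hi]
  have plus_term : ((6 - 8 * (i : ℂ) + 4 * (D : ℂ)) * ePlus D i) •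
      low (low (low (low (up (up w))))) =
        (4 * (i : ℂ) - 5 - 2 * D) • low (low (low (low (up (up w))))) := by
    rcases hi.eq_or_lt with rfl | hi'
    · have up_pow_two : up (up w) = 0 := by
        refine eq_zero_of_cardWeight_eq (k := 2 * i + 2) ?_ (Or.inr (by simp))
        rw [cardWeight_up (cardWeight_up hw), Fintype.card_fin]
        push_cast
        ring_nf
      simp only [up_pow_two, map_zero, smul_zero]
    · rw [denominator_mul_ePlus h1 hi']
  refine smul_right_injective _ (denominator_ne_zero D i) ?_
  have key := low_up_relation hw
  push_cast at key
  simp only [smul_add, smul_smul, minus_term, plus_term, fCoeff]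
  linear_combination (norm := module) key

theorem uniformRelationOn_graph {D i : ℕ} (h1 : 1 ≤ i) (hi : i ≤ D) (x : Vertex (2 * D + 1)) :
    UniformGraph.UniformRelationOn (graph (2 * D + 1)) x i (eMinus D i) (ePlus D i)
      (fCoeff D i) := by
  intro v hv
  obtain ⟨w, hw, rfl⟩ := exists_cardWeight_eq_and_comp_diffSet hv
  simp only [pow_two, Matrix.add_mulVec, Matrix.smul_mulVec, ← Matrix.mulVec_mulVec,
    lowering_mulVec, raising_mulVec, map_smul]
  ext y
  have key := congrFun (uniform_relation_low_up h1 hi hw) (diffSet x y)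
  simp only [Pi.add_apply, Pi.smul_apply, smul_eq_mul, Function.comp_apply] at key ⊢
  linear_combination key / 8

end UniformRelation

theorem isStronglyUniformStructure_flatFree {D : ℕ} (x : Vertex (2 * D + 1)) :
    UniformGraph.IsStronglyUniformStructure (UniformGraph.flatFree (graph (2 * D + 1)) x) x
      (paramMatrix D) (fun i => fCoeff D i.1) where
  connected := UniformGraph.connected_flatFree (connected_graph _) x
  bipartite := UniformGraph.isBipartite_flatFree _ x
  ecc_eq := by rw [UniformGraph.ecc_flatFree (connected_graph _), ecc_graph]; omega
  isParameterMatrix := isParameterMatrix_paramMatrix D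
  relation i := by
    have hi := Finset.mem_Icc.1 i.2
    rw [eMinus_paramMatrix, ePlus_paramMatrix,
      UniformGraph.uniformRelationOn_flatFree (connected_graph _)]
    exact uniformRelationOn_graph hi.1 hi.2 x
  eMinus_ne_zero i h2 hi := by rw [eMinus_paramMatrix]; exact eMinus_ne_zero h2 hi
  ePlus_ne_zero i h1 hi := by rw [ePlus_paramMatrix]; exact ePlus_ne_zero h1 hi

end HalvedCube

end

theorem theorem9p6_general {D : ℕ} (hD : 1 ≤ D) (x : HalvedCube.Vertex (2 * D + 1)) :
    (HalvedCube.graph (2 * D + 1)).diam = D ∧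
    (∀ i : ℕ, 1 ≤ i → i ≤ D →
      UniformGraph.UniformRelationOn (HalvedCube.graph (2 * D + 1)) x i
        (HalvedCube.eMinus D i) (HalvedCube.ePlus D i) (HalvedCube.fCoeff D i)) ∧
    (∀ i : ℕ, 1 ≤ i → i ≤ D → (6 - 8 * (i : ℂ) + 4 * (D : ℂ)) ≠ 0) ∧
    (∀ i : ℕ, 2 ≤ i → i ≤ D → HalvedCube.eMinus D i ≠ 0) ∧
    (∀ i : ℕ, 1 ≤ i → i + 1 ≤ D → HalvedCube.ePlus D i ≠ 0) ∧
    (∀ s t : ℕ, 1 ≤ s → s ≤ t → t ≤ D →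
      (∏ k ∈ Finset.range (t - s + 1),
        (2 * (D : ℂ) - 4 * (t : ℂ) + 3 + 4 * (k : ℂ))) ≠ 0 ∧
      (UniformGraph.principalSubmatrix (HalvedCube.paramMatrix D) s t).det =
        (((t : ℂ) - (s : ℂ) + 2) * (2 * (D : ℂ) - 2 * (t : ℂ) - 2 * (s : ℂ) + 3) *
          ∏ k ∈ Finset.range (t - s), (2 * (D : ℂ) - 4 * (t : ℂ) + 5 + 4 * (k : ℂ))) /
        (2 ^ (t - s + 1) *
          ∏ k ∈ Finset.range (t - s + 1), (2 * (D : ℂ) - 4 * (t : ℂ) + 3 + 4 * (k : ℂ))) ∧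
      (UniformGraph.principalSubmatrix (HalvedCube.paramMatrix D) s t).det ≠ 0) ∧
    UniformGraph.IsStronglyUniformStructure
      (UniformGraph.flatFree (HalvedCube.graph (2 * D + 1)) x) x
      (HalvedCube.paramMatrix D) (fun i => HalvedCube.fCoeff D i.1) ∧
    UniformGraph.SupportsStronglyUniformStructure (HalvedCube.graph (2 * D + 1)) x :=
  ⟨(HalvedCube.diam_graph _).trans (by omega),
    fun _ h1 hi => HalvedCube.uniformRelationOn_graph h1 hi x,
    fun i _ _ => HalvedCube.denominator_ne_zero D i,
    fun _ => HalvedCube.eMinus_ne_zero,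
    fun _ => HalvedCube.ePlus_ne_zero,
    fun s t hs hst ht => ⟨HalvedCube.prod_add_three_ne_zero D t (t - s + 1),
      HalvedCube.det_principalSubmatrix_paramMatrix hs hst ht,
      HalvedCube.det_principalSubmatrix_paramMatrix_ne_zero hs hst ht⟩,
    HalvedCube.isStronglyUniformStructure_flatFree x,
    HalvedCube.connected_graph _, HalvedCube.not_isBipartite_graph (by omega),
    D, _, _, HalvedCube.isStronglyUniformStructure_flatFree x⟩

theorem theorem9p6 (n D : ℕ) (hn : Odd n) (hn7 : 7 ≤ n) (hD : D = (n - 1) / 2)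
    (x : HalvedCube.Vertex n) :
    -- the diameter is `D`
    (HalvedCube.graph n).diam = D ∧
    -- the uniform relation on each `E*_i V`
    (∀ i : ℕ, 1 ≤ i → i ≤ D →
      UniformGraph.UniformRelationOn (HalvedCube.graph n) x i
        (HalvedCube.eMinus D i) (HalvedCube.ePlus D i) (HalvedCube.fCoeff D i)) ∧
    -- the denominators and the off-diagonal coefficients do not vanish
    (∀ i : ℕ, 1 ≤ i → i ≤ D → (6 - 8 * (i : ℂ) + 4 * (D : ℂ)) ≠ 0) ∧
    (∀ i : ℕ, 2 ≤ i → i ≤ D → HalvedCube.eMinus D i ≠ 0) ∧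
    (∀ i : ℕ, 1 ≤ i → i + 1 ≤ D → HalvedCube.ePlus D i ≠ 0) ∧
    -- the principal minors
    (∀ s t : ℕ, 1 ≤ s → s ≤ t → t ≤ D →
      (∏ k ∈ Finset.range (t - s + 1),
        (2 * (D : ℂ) - 4 * (t : ℂ) + 3 + 4 * (k : ℂ))) ≠ 0 ∧
      (UniformGraph.principalSubmatrix (HalvedCube.paramMatrix D) s t).det =
        (((t : ℂ) - (s : ℂ) + 2) * (2 * (D : ℂ) - 2 * (t : ℂ) - 2 * (s : ℂ) + 3) *
          ∏ k ∈ Finset.range (t - s), (2 * (D : ℂ) - 4 * (t : ℂ) + 5 + 4 * (k : ℂ))) /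
        (2 ^ (t - s + 1) *
          ∏ k ∈ Finset.range (t - s + 1), (2 * (D : ℂ) - 4 * (t : ℂ) + 3 + 4 * (k : ℂ))) ∧
      (UniformGraph.principalSubmatrix (HalvedCube.paramMatrix D) s t).det ≠ 0) ∧
    -- these data form a strongly uniform structure
    UniformGraph.IsStronglyUniformStructure (UniformGraph.flatFree (HalvedCube.graph n) x) x
      (HalvedCube.paramMatrix D) (fun i => HalvedCube.fCoeff D i.1) ∧
    UniformGraph.SupportsStronglyUniformStructure (HalvedCube.graph n) x := by
  obtain rfl : n = 2 * D + 1 := by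
    obtain ⟨k, rfl⟩ := hn
    omega
  exact theorem9p6_general (by omega) x
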